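/- Let $d\in\mathbb{N}$ and let $f,g:\mathbb{R}^d\to\mathbb{R}$ be continuously differentiable and bounded from below, where $\mathbb{R}^d$ carries the Euclidean norm. Call a differentiable curve $\tilde\gamma:[0,+\infty)\to\mathbb{R}^d$ an asymptotically critical path for $g$ if $\|\tilde\gamma'(s)\|=1$ for every $s\ge 0$ (one-sided derivative at $s=0$), $\tilde\gamma(s)$ has no $\omega$-limit (that is, no cluster point as $s\to+\infty$), and $\int_0^{+\infty}\|\nabla g(\tilde\gamma(s))\|\,ds<+\infty$; similarly for $f$. Assume that (i) $\|\nabla f(x)\|=\|\nabla g(x)\|$ for every $x\in\mathbb{R}^d$ (so that $f$ and $g$ have the same critical points and the same asymptotically critical paths); (ii) $f(z)=g(z)$ for every $z\in\mathbb{R}^d$ with $\nabla f(z)=\nabla g(z)=0$; (iii) $\liminf_{s\to+\infty}f(\tilde\gamma(s))=\liminf_{s\to+\infty}g(\tilde\gamma(s))$ for each (common) asymptotically critical path $\tilde\gamma$ of $f$ and $g$. Then $f=g$. -/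

import Mathlib

open Filter Set MeasureTheory Topology

namespace SlopeDetermination

noncomputable section

/-- The descent modulus `T[f](x) = ‖∇f(x)‖` of a (continuously differentiable) function `f`
on the Euclidean space `ℝᵈ`. -/
def slope {d : ℕ} (f : EuclideanSpace ℝ (Fin d) → ℝ) (x : EuclideanSpace ℝ (Fin d)) : ℝ :=
  ‖gradient f x‖

/-- The critical set `{x : T[f](x) = 0}`. -/
def criticalSet {d : ℕ} (f : EuclideanSpace ℝ (Fin d) → ℝ) : Set (EuclideanSpace ℝ (Fin d)) :=
  {x | slope f x = 0}

/-- The set of `ω`-limits of a curve: the cluster points of `γ s` as `s → +∞`.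
Only the values of `γ` at large times matter. -/
def omegaLim {d : ℕ} (γ : ℝ → EuclideanSpace ℝ (Fin d)) : Set (EuclideanSpace ℝ (Fin d)) :=
  {x | MapClusterPt x atTop γ}

/-- Asymptotically critical paths of `g`. A curve `[0, +∞) → ℝᵈ` is represented by a function
on `ℝ` of which only the restriction to `[0, +∞)` is used (the derivative at `0` is one-sided). -/
structure IsAsymptoticallyCriticalPath {d : ℕ} (g : EuclideanSpace ℝ (Fin d) → ℝ)
    (γ : ℝ → EuclideanSpace ℝ (Fin d)) : Prop where
  differentiable : DifferentiableOn ℝ γ (Ici 0)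
  unit_speed : ∀ s ∈ Ici (0 : ℝ), ‖derivWithin γ (Ici 0) s‖ = 1
  omegaLim_eq_empty : omegaLim γ = ∅
  integrable_slope : IntegrableOn (fun s => slope g (γ s)) (Ici 0) volume

end

end SlopeDetermination

/-! Suppose g exceeds f by h > 0 at some point, and follow a unit-speed curve from there along which
f descends almost as steeply as possible. Since the slopes agree, g falls at rate at most ‖∇f‖,
while f falls at rate at least (1 - ε)‖∇f‖. The gap g - f can thus lose only a small multiple of the
total drop of f, which is finite because f is bounded below. For small ε the curve therefore stays
forever in the closed set where g - f ≥ h/2 (`le_of_strict_barrier`), which contains no critical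
point. There f converges along the curve, so its slope is integrable and no ω-limit exists
(`isAsymptoticallyCriticalPath_of_descent`). The persistent gap contradicts equality of the liminfs.
Exchanging f and g gives equality. As ∇f is merely continuous, the flow uses a locally Lipschitz
approximation of -∇f/‖∇f‖ (`exists_descent_field`). -/

namespace SlopeDetermination

open scoped NNReal Manifold ContDiff RealInnerProductSpace

/-! ### Global integral curves -/

/-- A bounded, locally Lipschitz vector field has a global integral curve through every point. -/
theorem exists_global_integralCurve {E : Type*} [NormedAddCommGroup E] [NormedSpace ℝ E]
    [CompleteSpace E] {v : E → E} {x₀ : E}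
    (hlip : ∀ R : ℝ, ∃ K : ℝ≥0, LipschitzOnWith K v (Metric.closedBall x₀ R))
    (hbound : ∀ x, ‖v x‖ ≤ 1) :
    ∃ γ : ℝ → E, γ 0 = x₀ ∧ ∀ t, HasDerivAt γ (v (γ t)) t := by
  have hloc : ∀ n : ℕ, ∃ α : ℝ → E, α 0 = x₀ ∧
      ∀ t ∈ Ioo (-(n : ℝ)) n, HasDerivAt α (v (α t)) t ∧ α t ∈ Metric.closedBall x₀ n := by
    intro n
    obtain ⟨K, hK⟩ := hlip n
    have hn : (0 : ℝ) ≤ n := n.cast_nonneg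
    -- At speed at most 1, the ball of radius n confines solutions up to time n.
    have hP : IsPicardLindelof (fun _ => v) (tmin := -(n : ℝ)) (tmax := n)
        ⟨0, by constructor <;> linarith⟩ x₀ (n : ℝ≥0) 0 1 K :=
      .of_time_independent (fun x _ => by simpa using hbound x) (by simpa using hK) (by simp)
    obtain ⟨α, hα0, hα⟩ := hP.exists_eq_forall_mem_Icc_hasDerivWithinAt₀
    refine ⟨α, hα0, fun t ht => ⟨(hα t (Ioo_subset_Icc_self ht)).hasDerivAt
      (Icc_mem_nhds ht.1 ht.2), ?_⟩⟩
    have := (convex_Icc (-(n : ℝ)) n).norm_image_sub_le_of_norm_hasDerivWithin_le hα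
      (fun s _ => hbound (α s)) (x := 0) (y := t) (by constructor <;> linarith)
      (Ioo_subset_Icc_self ht)
    simp only [hα0, sub_zero, one_mul, Real.norm_eq_abs] at this
    rw [Metric.mem_closedBall, dist_eq_norm]
    exact this.trans (abs_le.2 ⟨ht.1.le, ht.2.le⟩)
  choose α hα0 hα using hloc
  have hagree : ∀ m n : ℕ, 0 < m → m ≤ n → EqOn (α m) (α n) (Ioo (-(m : ℝ)) m) := by
    intro m n hm hmn
    obtain ⟨K, hK⟩ := hlip n
    have hmn' : (m : ℝ) ≤ n := by exact_mod_cast hmn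
    have hm' : (0 : ℝ) < m := by exact_mod_cast hm
    refine ODE_solution_unique_of_mem_Ioo (v := fun _ => v) (t₀ := 0)
      (s := fun _ => Metric.closedBall x₀ n) (fun _ _ => hK) (by constructor <;> linarith)
      (fun t ht => ⟨(hα m t ht).1, Metric.closedBall_subset_closedBall hmn' (hα m t ht).2⟩)
      (fun t ht => hα n t (Ioo_subset_Ioo (neg_le_neg hmn') hmn' ht)) ?_
    rw [hα0, hα0]
  -- The extra 1 makes |t| < `N t` strict.
  let N : ℝ → ℕ := fun t => ⌈|t|⌉₊ + 1
  have hN : ∀ t, t ∈ Ioo (-(N t : ℝ)) (N t) := by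
    intro t
    have : |t| < N t := by
      have := Nat.le_ceil |t|
      simp only [N]; push_cast; linarith
    exact abs_lt.1 this
  have hγ : ∀ n : ℕ, 0 < n → ∀ t ∈ Ioo (-(n : ℝ)) n, α (N t) t = α n t := by
    intro n hn t ht
    rcases le_total (N t) n with h | h
    · exact hagree _ _ (Nat.succ_pos _) h (hN t)
    · exact (hagree _ _ hn h ht).symm
  refine ⟨fun t => α (N t) t, hα0 _, fun t => ?_⟩
  refine (hα (N t) t (hN t)).1.congr_of_eventuallyEq ?_
  filter_upwards [Ioo_mem_nhds (hN t).1 (hN t).2] with s hs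
  exact hγ _ (Nat.succ_pos _) s hs

/-! ### Lipschitz approximation of unit fields -/

/-- Radial normalization, truncated near the origin so as to be Lipschitz. -/
noncomputable def truncNormalize {E : Type*} [NormedAddCommGroup E] [NormedSpace ℝ E] (y : E) : E :=
  (max ‖y‖ (1 / 2))⁻¹ • y

section

variable {E : Type*} [NormedAddCommGroup E] [NormedSpace ℝ E]

theorem norm_truncNormalize_le (y : E) : ‖truncNormalize y‖ ≤ 1 := by
  have h : 0 < max ‖y‖ (1 / 2) := lt_max_of_lt_right (by norm_num)
  rw [truncNormalize, norm_smul, norm_inv, Real.norm_of_nonneg h.le, inv_mul_le_iff₀ h, mul_one]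
  exact le_max_left _ _

theorem truncNormalize_of_le {y : E} (hy : 1 / 2 ≤ ‖y‖) : truncNormalize y = ‖y‖⁻¹ • y := by
  rw [truncNormalize, max_eq_left hy]

theorem lipschitzWith_truncNormalize : LipschitzWith 4 (truncNormalize : E → E) := by
  refine LipschitzWith.of_dist_le_mul fun a b => ?_
  rw [dist_eq_norm, dist_eq_norm]
  have ha : 1 / 2 ≤ max ‖a‖ (1 / 2) := le_max_right _ _
  have hb : 1 / 2 ≤ max ‖b‖ (1 / 2) := le_max_right _ _
  have hbb : ‖b‖ ≤ max ‖b‖ (1 / 2) := le_max_left _ _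
  have hab : |max ‖b‖ (1 / 2) - max ‖a‖ (1 / 2)| ≤ ‖a - b‖ := by
    have h := abs_max_sub_max_le_abs ‖b‖ ‖a‖ (1 / 2)
    have h' := abs_norm_sub_norm_le b a
    rw [norm_sub_rev] at h'
    exact h.trans h'
  unfold truncNormalize
  generalize max ‖a‖ (1 / 2) = p at *
  generalize max ‖b‖ (1 / 2) = q at *
  have hp : 0 < p := by linarith
  have hq : 0 < q := by linarith
  have key : p⁻¹ • a - q⁻¹ • b = p⁻¹ • (a - b) + (p⁻¹ * ((q - p) * q⁻¹)) • b := by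
    have : p⁻¹ * ((q - p) * q⁻¹) = p⁻¹ - q⁻¹ := by field_simp
    rw [this, smul_sub, sub_smul]; abel
  have hpinv : p⁻¹ ≤ 2 := by
    rw [inv_le_comm₀ hp two_pos]; linarith
  have hqb : q⁻¹ * ‖b‖ ≤ 1 := by rwa [inv_mul_le_iff₀ hq, mul_one]
  calc ‖p⁻¹ • a - q⁻¹ • b‖ ≤ p⁻¹ * ‖a - b‖ + p⁻¹ * (|q - p| * (q⁻¹ * ‖b‖)) := by
        rw [key]
        refine (norm_add_le _ _).trans_eq ?_
        simp only [norm_smul, norm_mul, norm_inv, Real.norm_eq_abs, abs_of_pos hp, abs_of_pos hq]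
        ring
    _ ≤ 2 * ‖a - b‖ + 2 * (‖a - b‖ * 1) := by gcongr
    _ = ((4 : ℝ≥0) : ℝ) * ‖a - b‖ := by push_cast; ring

end

/-- A continuous unit vector field on a closed set is approximated there, to any precision, by
a unit vector field that is the restriction of a bounded and locally Lipschitz field. -/
theorem exists_locallyLipschitz_unit_approx {E : Type*} [NormedAddCommGroup E]
    [NormedSpace ℝ E] [FiniteDimensional ℝ E] {F : Set E} (hF : IsClosed F) {u : E → E}
    (hu : ∀ x ∈ F, ContinuousAt u x) (hunit : ∀ x ∈ F, ‖u x‖ = 1) {ε : ℝ} (hε : 0 < ε) :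
    ∃ v : E → E, (∀ (x₀ : E) (R : ℝ), ∃ K : ℝ≥0, LipschitzOnWith K v (Metric.closedBall x₀ R)) ∧
      (∀ x, ‖v x‖ ≤ 1) ∧ ∀ x ∈ F, ‖v x‖ = 1 ∧ ‖v x - u x‖ ≤ ε := by
  -- Approximation and renormalization each cost δ; the bound 1/2 keeps ‖w‖ ≥ 1/2 on `F`, where the
  -- truncation is inactive.
  set δ : ℝ := min (ε / 2) (1 / 2)
  have hδ : 0 < δ := by positivity
  -- Off `F` the convex constraint is vacuous, so local constants suffice and a partition of unity
  -- glues them.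
  obtain ⟨w, hw⟩ := exists_contMDiffMap_forall_mem_convex_of_local_const (n := 1) 𝓘(ℝ, E)
    (t := fun x => {y : E | x ∈ F → y ∈ Metric.closedBall (u x) δ})
    (fun x => by
      by_cases hx : x ∈ F
      · simp only [hx, forall_true_left]
        exact convex_closedBall (u x) δ
      · simpa [hx] using convex_univ)
    (fun x => by
      by_cases hx : x ∈ F
      · refine ⟨u x, ?_⟩
        filter_upwards [(hu x hx).eventually (Metric.ball_mem_nhds _ hδ)] with y hy _
        rw [Metric.mem_closedBall, dist_comm]
        exact (Metric.mem_ball.1 hy).le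
      · refine ⟨0, ?_⟩
        filter_upwards [hF.isOpen_compl.mem_nhds hx] with y hy hy'
        exact absurd hy' hy)
  have hwC : ContDiff ℝ 1 w := w.contMDiff.contDiff
  refine ⟨fun x => truncNormalize (w x), fun x₀ R => ?_, fun x => norm_truncNormalize_le _,
    fun x hx => ?_⟩
  · obtain ⟨K, hK⟩ := (hwC.locallyLipschitz.locallyLipschitzOn (s := Metric.closedBall x₀ R)
      ).exists_lipschitzOnWith_of_compact (isCompact_closedBall x₀ R)
    exact ⟨_, lipschitzWith_truncNormalize.comp_lipschitzOnWith hK⟩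
  · have h1 : ‖w x - u x‖ ≤ δ := by simpa [dist_eq_norm] using hw x hx
    have h2 : |‖w x‖ - 1| ≤ δ := by
      rw [← hunit x hx]; exact (abs_norm_sub_norm_le _ _).trans h1
    have h3 : 1 / 2 ≤ ‖w x‖ := by
      have := (abs_le.1 h2).1
      have := min_le_right (ε / 2) (1 / 2)
      linarith
    have h4 : 0 < ‖w x‖ := by linarith
    have h5 : ‖truncNormalize (w x) - w x‖ ≤ δ := by
      have : truncNormalize (w x) - w x = ((1 - ‖w x‖) * ‖w x‖⁻¹) • w x := by
        rw [truncNormalize_of_le h3, sub_mul, mul_inv_cancel₀ h4.ne', sub_smul, one_mul, one_smul]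
      rw [this, norm_smul, norm_mul, norm_inv, norm_norm, mul_assoc, inv_mul_cancel₀ h4.ne',
        mul_one, Real.norm_eq_abs, abs_sub_comm]
      exact h2
    refine ⟨?_, ?_⟩
    · beta_reduce
      rw [truncNormalize_of_le h3, norm_smul, norm_inv, norm_norm, inv_mul_cancel₀ h4.ne']
    · calc ‖truncNormalize (w x) - u x‖ ≤ ‖truncNormalize (w x) - w x‖ + ‖w x - u x‖ :=
            norm_sub_le_norm_sub_add_norm_sub _ _ _
        _ ≤ ε := by linarith [min_le_left (ε / 2) (1 / 2)]

/-! ### Descent fields and descent curves -/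

section

variable {E : Type*} [NormedAddCommGroup E] [InnerProductSpace ℝ E] [CompleteSpace E]

theorem hasDerivAt_comp_curve {f : E → ℝ} (hf : ContDiff ℝ 1 f) {γ : ℝ → E} {γ' : E} {s : ℝ}
    (hγ : HasDerivAt γ γ' s) :
    HasDerivAt (fun t => f (γ t)) ⟪gradient f (γ s), γ'⟫ s := by
  have h := ((hf.differentiable one_ne_zero) (γ s)).hasGradientAt.hasFDerivAt
  rw [← InnerProductSpace.toDual_apply_apply]
  exact h.comp_hasDerivAt s hγ

theorem continuous_gradient {f : E → ℝ} (hf : ContDiff ℝ 1 f) : Continuous (gradient f) :=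
  (InnerProductSpace.toDual ℝ E).symm.continuous.comp (hf.continuous_fderiv one_ne_zero)

/-- Near-steepest descent unit field on a closed set without critical points. -/
theorem exists_descent_field [FiniteDimensional ℝ E] {f : E → ℝ} (hf : ContDiff ℝ 1 f) {F : Set E}
    (hF : IsClosed F) (hcrit : ∀ x ∈ F, gradient f x ≠ 0) {ε : ℝ} (hε : 0 < ε) :
    ∃ v : E → E, (∀ (x₀ : E) (R : ℝ), ∃ K : ℝ≥0, LipschitzOnWith K v (Metric.closedBall x₀ R)) ∧
      (∀ x, ‖v x‖ ≤ 1) ∧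
      ∀ x ∈ F, ‖v x‖ = 1 ∧ ⟪gradient f x, v x⟫ ≤ -(1 - ε) * ‖gradient f x‖ := by
  have hcont := continuous_gradient hf
  obtain ⟨v, hlip, hle, hv⟩ := exists_locallyLipschitz_unit_approx hF
    (u := fun x => -(‖gradient f x‖⁻¹ • gradient f x))
    (fun x hx => ((hcont.norm.continuousAt.inv₀ (norm_ne_zero_iff.2 (hcrit x hx))).smul
      hcont.continuousAt).neg)
    (fun x hx => by
      rw [norm_neg, norm_smul, norm_inv, norm_norm,
        inv_mul_cancel₀ (norm_ne_zero_iff.2 (hcrit x hx))]) hε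
  refine ⟨v, hlip, hle, fun x hx => ⟨(hv x hx).1, ?_⟩⟩
  have hne := norm_ne_zero_iff.2 (hcrit x hx)
  have h := (real_inner_le_norm (gradient f x) (v x - -(‖gradient f x‖⁻¹ • gradient f x))).trans
    (mul_le_mul_of_nonneg_left (hv x hx).2 (norm_nonneg _))
  rw [inner_sub_right, inner_neg_right, inner_smul_right, real_inner_self_eq_norm_sq] at h
  have h' : ‖gradient f x‖⁻¹ * ‖gradient f x‖ ^ 2 = ‖gradient f x‖ := by field_simp
  rw [h'] at h
  linarith

end

/-- If a scalar function along a half-line starts above the level `b`, and stays strictly above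
it as long as it is at least `b`, then it never goes below `b`. -/
theorem le_of_strict_barrier {φ : ℝ → ℝ} (hφ : Continuous φ) {b : ℝ} (h0 : b ≤ φ 0)
    (hstep : ∀ T, 0 ≤ T → (∀ s ∈ Icc 0 T, b ≤ φ s) → b < φ T) {s : ℝ} (hs : 0 ≤ s) :
    b ≤ φ s := by
  by_contra! hlt
  have hne : (Icc 0 s ∩ φ ⁻¹' {b}).Nonempty := by
    obtain ⟨t, ht, htb⟩ := intermediate_value_Icc' hs hφ.continuousOn ⟨hlt.le, h0⟩
    exact ⟨t, ht, htb⟩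
  -- `T` is the first time at level `b`; before it φ cannot drop below `b`, so `hstep` applies at
  -- `T`.
  obtain ⟨T, ⟨hT, hTb⟩, hleast⟩ := (isCompact_Icc.inter_right
    (isClosed_singleton.preimage hφ)).exists_isLeast hne
  refine (hstep T hT.1 fun r hr => ?_).ne' hTb
  by_contra! hr'
  obtain ⟨t, ht, htb⟩ := intermediate_value_Icc' hr.1 hφ.continuousOn ⟨hr'.le, h0⟩
  have hTt : T ≤ t := hleast ⟨⟨ht.1, ht.2.trans (hr.2.trans hT.2)⟩, htb⟩
  have : T = r := le_antisymm (hTt.trans ht.2) hr.2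
  rw [← this, hTb] at hr'
  exact lt_irrefl _ hr'

/-- Along a unit-speed curve on which `f` descends at a rate comparable with its slope and
converges, no noncritical point is an `ω`-limit. -/
theorem gradient_eq_zero_of_mem_omegaLim {d : ℕ} {f : EuclideanSpace ℝ (Fin d) → ℝ}
    (hf : ContDiff ℝ 1 f) {γ γ' : ℝ → EuclideanSpace ℝ (Fin d)} {κ ℓ : ℝ} (hκ : 0 < κ)
    (hγ : ∀ s, HasDerivAt γ (γ' s) s) (hspeed : ∀ s, ‖γ' s‖ ≤ 1)
    (hdesc : ∀ s, 0 ≤ s → ⟪gradient f (γ s), γ' s⟫ ≤ -κ * ‖gradient f (γ s)‖)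
    (hlim : Tendsto (fun s => f (γ s)) atTop (𝓝 ℓ)) {z : EuclideanSpace ℝ (Fin d)}
    (hz : z ∈ omegaLim γ) : gradient f z = 0 := by
  by_contra hne
  have hpos : 0 < ‖gradient f z‖ := norm_pos_iff.2 hne
  set a : ℝ := ‖gradient f z‖ / 2 with ha
  have hapos : 0 < a := half_pos hpos
  obtain ⟨r, hr, hball⟩ := Metric.eventually_nhds_iff_ball.1
    ((continuous_gradient hf).norm.continuousAt.eventually
      (lt_mem_nhds (show a < ‖gradient f z‖ by linarith)))
  -- Each visit near z costs f at least κa(r/2) within time r/2, whereas convergence makes such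
  -- drops vanish.
  have hdiff : Tendsto (fun s => f (γ s) - f (γ (s + r / 2))) atTop (𝓝 0) := by
    have := hlim.sub (hlim.comp (tendsto_atTop_add_const_right atTop (r / 2) tendsto_id))
    simpa using this
  have hev := (hdiff.eventually (gt_mem_nhds (show 0 < κ * a * (r / 2) by positivity))).and
    (eventually_ge_atTop 0)
  obtain ⟨s, hsz, hsmall, hs0⟩ := ((mapClusterPt_iff_frequently.1 hz (Metric.ball z (r / 2))
    (Metric.ball_mem_nhds _ (half_pos hr))).and_eventually hev).exists
  have hstay : ∀ t ∈ Icc s (s + r / 2), γ t ∈ Metric.ball z r := by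
    intro t ht
    have := convex_univ.norm_image_sub_le_of_norm_hasDerivWithin_le (f := γ)
      (fun x _ => (hγ x).hasDerivWithinAt) (fun x _ => hspeed x) (mem_univ s) (mem_univ t)
    rw [one_mul, Real.norm_of_nonneg (sub_nonneg.2 ht.1), ← dist_eq_norm] at this
    calc dist (γ t) z ≤ dist (γ t) (γ s) + dist (γ s) z := dist_triangle _ _ _
      _ < r := by have := Metric.mem_ball.1 hsz; linarith [ht.2]
  have hderiv : ∀ t, HasDerivAt (fun t => f (γ t)) ⟪gradient f (γ t), γ' t⟫ t :=
    fun t => hasDerivAt_comp_curve hf (hγ t)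
  have hle := (convex_Icc s (s + r / 2)).image_sub_le_mul_sub_of_deriv_le (C := -(κ * a))
    (f := fun t => f (γ t)) (fun t _ => (hderiv t).continuousAt.continuousWithinAt)
    (fun t _ => (hderiv t).differentiableAt.differentiableWithinAt)
    (fun t ht => by
      have ht' := interior_subset ht
      rw [(hderiv t).deriv]
      have h1 := hdesc t (hs0.trans ht'.1)
      have h2 := mul_le_mul_of_nonneg_left (hball _ (hstay t ht')).le hκ.le
      linarith)
    s (left_mem_Icc.2 (by linarith)) (s + r / 2) (right_mem_Icc.2 (by linarith)) (by linarith)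
  have : -(κ * a) * (s + r / 2 - s) = -(κ * a * (r / 2)) := by ring
  rw [this] at hle
  linarith

/-- A global curve along which `f` descends at a rate comparable with its slope is an
asymptotically critical path, as soon as it stays in a closed set without critical points
and `f` converges along it. -/
theorem isAsymptoticallyCriticalPath_of_descent {d : ℕ} {f : EuclideanSpace ℝ (Fin d) → ℝ}
    (hf : ContDiff ℝ 1 f) {γ γ' : ℝ → EuclideanSpace ℝ (Fin d)} {κ ℓ : ℝ} (hκ : 0 < κ)
    (hγ : ∀ s, HasDerivAt γ (γ' s) s) (hspeed : ∀ s, ‖γ' s‖ ≤ 1)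
    (hunit : ∀ s, 0 ≤ s → ‖γ' s‖ = 1)
    (hdesc : ∀ s, 0 ≤ s → ⟪gradient f (γ s), γ' s⟫ ≤ -κ * ‖gradient f (γ s)‖)
    (hlim : Tendsto (fun s => f (γ s)) atTop (𝓝 ℓ))
    {F : Set (EuclideanSpace ℝ (Fin d))} (hF : IsClosed F) (hcrit : ∀ x ∈ F, gradient f x ≠ 0)
    (hmem : ∀ s, 0 ≤ s → γ s ∈ F) : IsAsymptoticallyCriticalPath f γ where
  differentiable s _ := (hγ s).differentiableAt.differentiableWithinAt
  unit_speed s hs := by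
    rw [(hγ s).hasDerivWithinAt.derivWithin (uniqueDiffOn_Ici 0 s hs), hunit s hs]
  omegaLim_eq_empty := by
    refine eq_empty_of_forall_notMem fun z hz => ?_
    refine hcrit z ?_ (gradient_eq_zero_of_mem_omegaLim hf hκ hγ hspeed hdesc hlim hz)
    exact hF.mem_of_mapClusterPt hz ((eventually_ge_atTop 0).mono hmem)
  integrable_slope := by
    have hγc : Continuous γ := continuous_iff_continuousAt.2 fun s => (hγ s).continuousAt
    have hint := integrableOn_Ioi_deriv_of_nonpos' (a := 0)
      (fun s _ => hasDerivAt_comp_curve hf (hγ s))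
      (fun s hs => (hdesc s (le_of_lt hs)).trans (by
        have := mul_nonneg hκ.le (norm_nonneg (gradient f (γ s)))
        linarith)) hlim
    rw [integrableOn_Ici_iff_integrableOn_Ioi]
    refine (hint.const_mul (-κ⁻¹)).mono'
      ((continuous_gradient hf).norm.comp hγc).aestronglyMeasurable ?_
    refine (ae_restrict_iff' measurableSet_Ioi).2 (.of_forall fun s hs => ?_)
    rw [slope, norm_norm]
    have h := mul_le_mul_of_nonneg_left (hdesc s (le_of_lt hs)) (inv_nonneg.2 hκ.le)
    rw [← mul_assoc, mul_neg, inv_mul_cancel₀ hκ.ne'] at h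
    linarith

/-! ### Comparison along a descent curve -/

/-- One-sided comparison: functions with the same slope that agree at critical points and
asymptotically along asymptotically critical paths are ordered. -/
theorem le_of_slope_eq {d : ℕ} {f g : EuclideanSpace ℝ (Fin d) → ℝ}
    (hf : ContDiff ℝ 1 f) (hg : ContDiff ℝ 1 g) (hf_bdd : BddBelow (range f))
    (h_slope : ∀ x, slope f x = slope g x)
    (h_crit : ∀ z, z ∈ criticalSet f → z ∈ criticalSet g → f z = g z)
    (h_path : ∀ γ : ℝ → EuclideanSpace ℝ (Fin d),
      IsAsymptoticallyCriticalPath f γ → IsAsymptoticallyCriticalPath g γ →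
      liminf (fun s : ℝ => ((f (γ s) : ℝ) : EReal)) atTop =
        liminf (fun s : ℝ => ((g (γ s) : ℝ) : EReal)) atTop)
    (x₀ : EuclideanSpace ℝ (Fin d)) : g x₀ ≤ f x₀ := by
  by_contra! hlt
  obtain ⟨m, hm⟩ := hf_bdd
  have hm' : ∀ x, m ≤ f x := fun x => hm (mem_range_self x)
  obtain ⟨h, hh⟩ : ∃ h, h = g x₀ - f x₀ := ⟨_, rfl⟩
  have hpos : 0 < h := by linarith
  have hM : 0 ≤ f x₀ - m := sub_nonneg.2 (hm' x₀)
  -- The gap may lose at most h/4 in total; the +1 below covers f x₀ = m.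
  obtain ⟨c, hc, hcM⟩ : ∃ c : ℝ, 0 < c ∧ c * (f x₀ - m) ≤ h / 4 := by
    refine ⟨h / 4 / (f x₀ - m + 1), by positivity, ?_⟩
    rw [div_mul_eq_mul_div, div_le_iff₀ (by linarith)]
    exact mul_le_mul_of_nonneg_left (by linarith) (by linarith)
  -- Equivalently (1 + c)(1 - ε) = 1, which makes g - (1 + c)f nondecreasing along the curve in `F`.
  obtain ⟨ε, hε, hε1, hcε⟩ : ∃ ε : ℝ, 0 < ε ∧ 0 < 1 - ε ∧ c * (1 - ε) = ε := by
    refine ⟨c / (1 + c), by positivity, ?_, ?_⟩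
    · rw [one_sub_div (by positivity)]; ring_nf; positivity
    · field_simp; ring
  set F : Set (EuclideanSpace ℝ (Fin d)) := {x | f x + h / 2 ≤ g x}
  have hF : IsClosed F := isClosed_le (hf.continuous.add continuous_const) hg.continuous
  have hcrit : ∀ x ∈ F, gradient f x ≠ 0 := by
    intro x hx h0
    have hsf : slope f x = 0 := by rw [slope, h0, norm_zero]
    have := h_crit x hsf ((h_slope x).symm.trans hsf)
    have hx' : f x + h / 2 ≤ g x := hx
    linarith
  obtain ⟨v, hlip, hle, hv⟩ := exists_descent_field hf hF hcrit hε
  obtain ⟨γ, hγ0, hγ⟩ := exists_global_integralCurve (hlip x₀) hle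
  have hγc : Continuous γ := continuous_iff_continuousAt.2 fun s => (hγ s).continuousAt
  have hfd := fun s => hasDerivAt_comp_curve hf (hγ s)
  have hgd := fun s => hasDerivAt_comp_curve hg (hγ s)
  have hgap : ∀ x ∈ F, 0 ≤ (1 + c) * -⟪gradient f x, v x⟫ + ⟪gradient g x, v x⟫ := by
    intro x hx
    have h1 := (hv x hx).2
    have h2 := neg_le_of_abs_le (abs_real_inner_le_norm (gradient g x) (v x))
    have h3 : ‖gradient f x‖ = ‖gradient g x‖ := h_slope x
    rw [(hv x hx).1, mul_one, ← h3] at h2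
    have h4 := mul_le_mul_of_nonneg_left h1 (show 0 ≤ 1 + c by positivity)
    have h5 : (1 + c) * (-(1 - ε) * ‖gradient f x‖) = -‖gradient f x‖ := by
      have : (1 + c) * (1 - ε) = 1 := by rw [add_mul, hcε]; ring
      linear_combination (-‖gradient f x‖) * this
    linarith
  have hmem : ∀ s, 0 ≤ s → γ s ∈ F := by
    intro s hs
    suffices h / 2 ≤ g (γ s) - f (γ s) by
      change f (γ s) + h / 2 ≤ g (γ s)
      linarith
    refine le_of_strict_barrier (φ := fun s => g (γ s) - f (γ s))
      ((hg.continuous.comp hγc).sub (hf.continuous.comp hγc)) (by simp only [hγ0]; linarith)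
      (fun T hT hstay => ?_) hs
    have hder : ∀ t, HasDerivAt (fun t => g (γ t) - (1 + c) * f (γ t))
        (⟪gradient g (γ t), v (γ t)⟫ - (1 + c) * ⟪gradient f (γ t), v (γ t)⟫) t :=
      fun t => (hgd t).sub ((hfd t).const_mul (1 + c))
    have hmono : MonotoneOn (fun t => g (γ t) - (1 + c) * f (γ t)) (Icc 0 T) := by
      refine monotoneOn_of_deriv_nonneg (convex_Icc 0 T)
        (fun t _ => (hder t).continuousAt.continuousWithinAt)
        (fun t _ => (hder t).differentiableAt.differentiableWithinAt) fun t ht => ?_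
      rw [(hder t).deriv]
      have hmemt : γ t ∈ F := by
        have := hstay t (interior_subset ht)
        change f (γ t) + h / 2 ≤ g (γ t)
        linarith
      linarith [hgap _ hmemt]
    -- Hence the gap at `T` is at least h - c(f x₀ - m) ≥ 3h/4 > h/2.
    have h1 := hmono (left_mem_Icc.2 hT) (right_mem_Icc.2 hT) hT
    simp only [hγ0] at h1
    have h2 := mul_le_mul_of_nonneg_left (hm' (γ T)) hc.le
    linarith
  have hdesc : ∀ s, 0 ≤ s → ⟪gradient f (γ s), v (γ s)⟫ ≤ -(1 - ε) * ‖gradient f (γ s)‖ :=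
    fun s hs => (hv _ (hmem s hs)).2
  obtain ⟨ℓ, hlim⟩ : ∃ ℓ, Tendsto (fun s => f (γ s)) atTop (𝓝 ℓ) := by
    have hanti : AntitoneOn (fun s => f (γ s)) (Ici 0) := by
      refine antitoneOn_of_deriv_nonpos (convex_Ici 0)
        (fun t _ => (hfd t).continuousAt.continuousWithinAt)
        (fun t _ => (hfd t).differentiableAt.differentiableWithinAt) fun t ht => ?_
      rw [(hfd t).deriv]
      have := mul_nonneg hε1.le (norm_nonneg (gradient f (γ t)))
      linarith [hdesc t (interior_subset ht)]
    have hanti' : Antitone fun s => f (γ (max s 0)) := fun a b hab =>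
      hanti (mem_Ici.2 (le_max_right _ _)) (mem_Ici.2 (le_max_right _ _)) (max_le_max_right 0 hab)
    refine ⟨_, (tendsto_atTop_ciInf hanti' ⟨m, ?_⟩).congr' ?_⟩
    · rintro _ ⟨s, rfl⟩
      exact hm' _
    · filter_upwards [eventually_ge_atTop 0] with s hs
      rw [max_eq_left hs]
  have hpf := isAsymptoticallyCriticalPath_of_descent hf hε1 hγ (fun s => hle _)
    (fun s hs => (hv _ (hmem s hs)).1) hdesc hlim hF hcrit hmem
  have hpg : IsAsymptoticallyCriticalPath g γ :=
    { hpf with integrable_slope := by simpa only [h_slope] using hpf.integrable_slope }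
  have hliminf := h_path γ hpf hpg
  have hlimE : Tendsto (fun s => ((f (γ s) : ℝ) : EReal)) atTop (𝓝 (ℓ : EReal)) :=
    (continuous_coe_real_ereal.tendsto ℓ).comp hlim
  rw [hlimE.liminf_eq] at hliminf
  -- Of the gap h/2, a part h/4 absorbs the error in f → ℓ.
  have hge : ((ℓ + h / 4 : ℝ) : EReal) ≤ liminf (fun s : ℝ => ((g (γ s) : ℝ) : EReal)) atTop := by
    refine le_liminf_of_le (h := ?_)
    filter_upwards [hlim.eventually (lt_mem_nhds (show ℓ - h / 4 < ℓ by linarith)),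
      eventually_ge_atTop 0] with s hs hs0
    have : f (γ s) + h / 2 ≤ g (γ s) := hmem s hs0
    exact EReal.coe_le_coe_iff.2 (by linarith)
  rw [← hliminf, EReal.coe_le_coe_iff] at hge
  linarith

end SlopeDetermination

theorem theorem2p6 (d : ℕ) (f g : EuclideanSpace ℝ (Fin d) → ℝ)
    (hf : ContDiff ℝ 1 f) (hg : ContDiff ℝ 1 g)
    (hf_bdd : BddBelow (Set.range f)) (hg_bdd : BddBelow (Set.range g))
    (h_slope : ∀ x, SlopeDetermination.slope f x = SlopeDetermination.slope g x)
    (h_crit : ∀ z, z ∈ SlopeDetermination.criticalSet f →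
      z ∈ SlopeDetermination.criticalSet g → f z = g z)
    (h_path : ∀ γ : ℝ → EuclideanSpace ℝ (Fin d),
      SlopeDetermination.IsAsymptoticallyCriticalPath f γ →
      SlopeDetermination.IsAsymptoticallyCriticalPath g γ →
      Filter.liminf (fun s : ℝ => ((f (γ s) : ℝ) : EReal)) Filter.atTop =
        Filter.liminf (fun s : ℝ => ((g (γ s) : ℝ) : EReal)) Filter.atTop) :
    f = g := by
  funext x
  exact le_antisymm
    (SlopeDetermination.le_of_slope_eq hg hf hg_bdd (fun x => (h_slope x).symm)
      (fun z hz hz' => (h_crit z hz' hz).symm) (fun γ hγ hγ' => (h_path γ hγ' hγ).symm) x)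
    (SlopeDetermination.le_of_slope_eq hf hg hf_bdd h_slope h_crit h_path x)
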